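/- Let $\mathcal D(\mathbb R^d)$ be the space of smooth, compactly supported functions $\mathbb R^d\to\mathbb R$ with its usual topology, and let $(\Omega,\mathcal F,\mathbb P)$ be a probability space. A generalized random process is a map $s$ assigning to each $\varphi\in\mathcal D(\mathbb R^d)$ a real random variable $\langle s,\varphi\rangle$ such that $\langle s,\varphi_1+\lambda\varphi_2\rangle=\langle s,\varphi_1\rangle+\lambda\langle s,\varphi_2\rangle$ almost surely for all $\varphi_1,\varphi_2\in\mathcal D(\mathbb R^d)$, $\lambda\in\mathbb R$, and such that $\varphi_n\to\varphi$ in $\mathcal D(\mathbb R^d)$ implies $\langle s,\varphi_n\rangle\to\langle s,\varphi\rangle$ in probability. A Lévy exponent is a continuous function $\psi:\mathbb R\to\mathbb C$ with $\psi(0)=0$ such that $e^{\psi}$ is the characteristic function of an infinitely divisible probability law on $\mathbb R$. A Lévy white noise with Lévy exponent $\psi$ is a generalized random process $\dot X$ such that $\mathbb E\big[e^{i\langle\dot X,\varphi\rangle}\big]=\exp\big(\int_{\mathbb R^d}\psi(\varphi(t))\,dt\big)$ for all $\varphi\in\mathcal D(\mathbb R^d)$. A mollifier is a function $\theta\in\mathcal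 D(\mathbb R^d)$ with $\theta\ge 0$ and $\int_{\mathbb R^d}\theta(t)\,dt=1$; put $\theta_n(t)=n^d\theta(nt)$. **Proposition 3.2.** Let $\dot X$ be a Lévy white noise with Lévy exponent $\psi$, and let $\varphi\in\mathcal D(\mathbb R^d)$. 1. For every Borel set $A\subset\mathbb R^d$ and every mollifier $\theta$, the functions $\varphi\,(\theta_n*\mathbf 1_A)$ belong to $\mathcal D(\mathbb R^d)$, the limit in probability $$\langle\dot X,\varphi\mathbf 1_A\rangle:=\lim_{n\to\infty}\langle\dot X,\varphi\,(\theta_n*\mathbf 1_A)\rangle$$ exists, and (up to almost sure equality) it does not depend on the choice of $\theta$. 2. For every Borel set $A\subset\mathbb R^d$ and every $\xi\in\mathbb R$, $$\mathbb E\big[e^{i\xi\langle\dot X,\varphi\mathbf 1_A\rangle}\big]=\exp\Big(\int_A\psi(\xi\varphi(t))\,dt\Big).$$ 3. For all disjoint Borel sets $A,B\subset\mathbb R^d$, $\langle\dot X,\varphi\mathbf 1_{A\cup B}\rangle=\langle\dot X,\varphi\mathbf 1_A\rangle+\langle\dot X,\varphi\mathbf 1_B\rangle$ almost surely, and the random variables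 $\langle\dot X,\varphi\mathbf 1_A\rangle$ and $\langle\dot X,\varphi\mathbf 1_B\rangle$ are independent. -/

import Mathlib

open MeasureTheory ProbabilityTheory Filter Topology
open scoped Distributions Convolution

noncomputable section

namespace LevyNoise

/-- The space `𝒟(ℝ^d)` of smooth compactly supported functions `ℝ^d → ℝ`, with its usual
(inductive limit) topology. -/
abbrev Test (d : ℕ) : Type := 𝓓((⊤ : TopologicalSpace.Opens (EuclideanSpace ℝ (Fin d))), ℝ)

/-- A generalized random process over `(Ω, P)`: an almost surely linear map from `𝒟(ℝ^d)` to
real random variables, which maps sequences that converge in `𝒟(ℝ^d)` to sequences that converge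
in probability. -/
structure GeneralizedRandomProcess (d : ℕ) {Ω : Type*} [MeasurableSpace Ω] (P : Measure Ω) where
  /-- The random variable `⟨s, φ⟩`. -/
  pairing : Test d → Ω → ℝ
  measurable_pairing : ∀ φ, Measurable (pairing φ)
  linear : ∀ (φ₁ φ₂ : Test d) (c : ℝ),
    pairing (φ₁ + c • φ₂) =ᵐ[P] fun ω => pairing φ₁ ω + c * pairing φ₂ ω
  continuous : ∀ (φ : ℕ → Test d) (φ₀ : Test d), Tendsto φ atTop (𝓝 φ₀) →
    TendstoInMeasure P (fun n => pairing (φ n)) atTop (pairing φ₀)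

/-- A law on `ℝ` is infinitely divisible if for every `n ≥ 1` it is the law of a sum of `n`
independent, identically distributed random variables. -/
def IsInfinitelyDivisible (μ : Measure ℝ) : Prop :=
  ∀ n : ℕ, 1 ≤ n → ∃ ν : Measure ℝ, IsProbabilityMeasure ν ∧
    (Measure.pi (fun _ : Fin n => ν)).map (fun y => ∑ i, y i) = μ

/-- `ψ` is a Lévy exponent: the continuous function with `ψ 0 = 0` such that `exp ψ` is the
characteristic function of an infinitely divisible probability law. -/
def IsLevyExponent (ψ : ℝ → ℂ) : Prop :=
  Continuous ψ ∧ ψ 0 = 0 ∧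
    ∃ μ : Measure ℝ, IsProbabilityMeasure μ ∧ IsInfinitelyDivisible μ ∧
      ∀ ξ : ℝ, charFun μ ξ = Complex.exp (ψ ξ)

/-- `X` is a Lévy white noise with Lévy exponent `ψ`: its characteristic functional is
`φ ↦ exp (∫ ψ (φ t) dt)`. -/
def IsLevyWhiteNoise {d : ℕ} {Ω : Type*} [MeasurableSpace Ω] {P : Measure Ω}
    (X : GeneralizedRandomProcess d P) (ψ : ℝ → ℂ) : Prop :=
  IsLevyExponent ψ ∧ ∀ φ : Test d,
    ∫ ω, Complex.exp (Complex.I * (X.pairing φ ω : ℂ)) ∂P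
      = Complex.exp (∫ t : EuclideanSpace ℝ (Fin d), ψ (φ t))

/-- A mollifier: `θ ∈ 𝒟(ℝ^d)` with `θ ≥ 0` and `∫ θ = 1`. -/
def IsMollifier {d : ℕ} (θ : Test d) : Prop :=
  (∀ t, 0 ≤ θ t) ∧ ∫ t, θ t = 1

/-- The rescaled function `θ_n (t) = n ^ d * θ (n t)`. -/
def scaled {d : ℕ} (θ : Test d) (n : ℕ) (t : EuclideanSpace ℝ (Fin d)) : ℝ :=
  (n : ℝ) ^ d * θ ((n : ℝ) • t)

theorem contDiff_scaled {d : ℕ} (θ : Test d) (n : ℕ) : ContDiff ℝ ((⊤ : ℕ∞) : WithTop ℕ∞) (scaled θ n) :=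
  contDiff_const.mul (θ.contDiff.comp (contDiff_const_smul (n : ℝ)))

theorem hasCompactSupport_scaled {d : ℕ} (θ : Test d) (n : ℕ) :
    HasCompactSupport (scaled θ n) := by
  rcases Nat.eq_zero_or_pos n with rfl | hn
  · rcases Nat.eq_zero_or_pos d with rfl | hd
    · exact (isClosed_tsupport _).isCompact
    · have h : scaled θ 0 = 0 := by
        funext t
        simp [scaled, hd.ne']
      rw [h]
      exact HasCompactSupport.zero
  · have h0 : (n : ℝ) ≠ 0 := by exact_mod_cast hn.ne'
    exact (θ.hasCompactSupport.comp_homeomorph (Homeomorph.smulOfNeZero (n : ℝ) h0)).mul_left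

/-- The function `θ_n * 𝟙_A` (convolution with respect to Lebesgue measure). -/
def mollifiedIndicator {d : ℕ} (θ : Test d) (n : ℕ) (A : Set (EuclideanSpace ℝ (Fin d))) :
    EuclideanSpace ℝ (Fin d) → ℝ :=
  scaled θ n ⋆[ContinuousLinearMap.mul ℝ ℝ, volume] A.indicator (fun _ => (1 : ℝ))

theorem contDiff_mollifiedIndicator {d : ℕ} (θ : Test d) (n : ℕ)
    {A : Set (EuclideanSpace ℝ (Fin d))} (hA : MeasurableSet A) :
    ContDiff ℝ ((⊤ : ℕ∞) : WithTop ℕ∞) (mollifiedIndicator θ n A) :=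
  (hasCompactSupport_scaled θ n).contDiff_convolution_left _ (contDiff_scaled θ n)
    ((locallyIntegrable_const (1 : ℝ)).indicator hA)

/-- The test function `φ (θ_n * 𝟙_A) ∈ 𝒟(ℝ^d)`, for a Borel set `A`. -/
def cutoff {d : ℕ} (φ θ : Test d) (n : ℕ) {A : Set (EuclideanSpace ℝ (Fin d))}
    (hA : MeasurableSet A) : Test d where
  toFun t := φ t * mollifiedIndicator θ n A t
  contDiff' := φ.contDiff.mul (contDiff_mollifiedIndicator θ n hA)
  hasCompactSupport' := φ.hasCompactSupport.mul_right
  tsupport_subset' := fun _ _ => trivial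

/-- `Y` is a value of `⟨X, φ 𝟙_A⟩` computed with `θ`: a random variable to which
`⟨X, φ (θ_n * 𝟙_A)⟩` converges in probability as `n → ∞`. -/
def IsPairingLimit {d : ℕ} {Ω : Type*} [MeasurableSpace Ω] {P : Measure Ω}
    (X : GeneralizedRandomProcess d P) (φ θ : Test d) {A : Set (EuclideanSpace ℝ (Fin d))}
    (hA : MeasurableSet A) (Y : Ω → ℝ) : Prop :=
  Measurable Y ∧ TendstoInMeasure P (fun n : ℕ => X.pairing (cutoff φ θ n hA)) atTop Y

end LevyNoise

end

/-! Everything is read off characteristic functions. If test functions `g i` are dominated by a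
multiple of `|φ|` and converge a.e. to `G`, then dominated convergence sends the characteristic
function of `⟨X, g i⟩` at `ξ` to `exp (∫ ψ (ξ G))` (`tendsto_charFun`). When `G = 0` this limit is
`1`, so `⟨X, g i⟩ → 0` in probability. Applied to differences, this makes `⟨X, g n⟩` Cauchy in
probability, hence convergent, and shows that the limit depends only on `G` (`exists_limit`,
`limit_unique`).

The cutoffs `φ (θ_n * 𝟙_A)` fit this scheme with `G = φ 𝟙_A`: they are bounded by `|φ|` and converge
a.e. by Lebesgue differentiation. Additivity is `limit_unique` for `φ 𝟙_A + φ 𝟙_B = φ 𝟙_(A ∪ B)`.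
Independence holds because `ψ 0 = 0` splits `∫ ψ (a φ 𝟙_A + b φ 𝟙_B)` into two integrals when `A`
and `B` are disjoint, so the joint characteristic function factors. -/

noncomputable section

namespace LevyNoise

/-! ### Convergence in probability and characteristic functions -/

section ConvergenceInMeasure

variable {Ω : Type*} [MeasurableSpace Ω] {P : Measure Ω}

theorem TendstoInMeasure.linearCombination [IsFiniteMeasure P] {f g : ℕ → Ω → ℝ} {F G : Ω → ℝ}
    (hf : ∀ n, Measurable (f n)) (hg : ∀ n, Measurable (g n))
    (hF : TendstoInMeasure P f atTop F) (hG : TendstoInMeasure P g atTop G) (a b : ℝ) :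
    TendstoInMeasure P (fun n ω => a * f n ω + b * g n ω) atTop
      (fun ω => a * F ω + b * G ω) := by
  have hm : ∀ n, AEStronglyMeasurable (fun ω => a * f n ω + b * g n ω) P := fun n =>
    (((hf n).const_mul a).add ((hg n).const_mul b)).aestronglyMeasurable
  -- Subsequence criterion: each subsequence is refined twice, once for `f` and once for `g`, to
  -- converge a.e.
  rw [exists_seq_tendstoInMeasure_atTop_iff hm]
  intro ns hns
  obtain ⟨ms, hms, h₁⟩ := (hF.comp hns.tendsto_atTop).exists_seq_tendsto_ae
  obtain ⟨ks, hks, h₂⟩ :=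
    (hG.comp (hns.tendsto_atTop.comp hms.tendsto_atTop)).exists_seq_tendsto_ae
  refine ⟨ms ∘ ks, hms.comp hks, ?_⟩
  filter_upwards [h₁, h₂] with ω hω₁ hω₂
  exact ((hω₁.comp hks.tendsto_atTop).const_mul a).add (hω₂.const_mul b)

/-- Real random variables are complete for convergence in measure. -/
theorem exists_tendstoInMeasure_of_cauchy [IsFiniteMeasure P] {Y : ℕ → Ω → ℝ}
    (hY : ∀ n, Measurable (Y n))
    (hC : TendstoInMeasure P (fun (p : ℕ × ℕ) ω => Y p.1 ω - Y p.2 ω) atTop 0) :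
    ∃ Z : Ω → ℝ, Measurable Z ∧ TendstoInMeasure P Y atTop Z := by
  rw [tendstoInMeasure_iff_norm] at hC
  -- Rates `2 ^ (-k)` serve twice: the probabilities are summable for Borel–Cantelli, and the
  -- increments are summable pathwise.
  have hN : ∀ k : ℕ, ∃ N : ℕ, ∀ i ≥ N, ∀ j ≥ N,
      P {ω | (1 / 2 : ℝ) ^ k ≤ ‖Y i ω - Y j ω‖} ≤ (2⁻¹ : ENNReal) ^ k := by
    intro k
    have h := (hC ((1 / 2 : ℝ) ^ k) (by positivity)).eventually_le_const
      (ENNReal.pow_pos (show (0 : ENNReal) < 2⁻¹ by simp) k)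
    obtain ⟨⟨a, b⟩, hab⟩ := eventually_atTop.1 h
    refine ⟨max a b, fun i hi j hj => ?_⟩
    simpa using hab (i, j) ⟨(le_max_left _ _).trans hi, (le_max_right _ _).trans hj⟩
  choose N hN using hN
  obtain ⟨ns, hns, hnN⟩ : ∃ ns : ℕ → ℕ, StrictMono ns ∧ ∀ k, N k ≤ ns k :=
    extraction_forall_of_eventually' (P := fun k n => N k ≤ n)
      fun k => ⟨N k, fun n hn => hn⟩
  have hsum : ∑' k, P {ω | (1 / 2 : ℝ) ^ k ≤ ‖Y (ns k) ω - Y (ns (k + 1)) ω‖} ≠ ⊤ := by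
    refine ne_top_of_le_ne_top ?_ (ENNReal.tsum_le_tsum fun k =>
      hN k (ns k) (hnN k) (ns (k + 1)) ((hnN k).trans (hns.monotone k.le_succ)))
    rw [ENNReal.tsum_geometric, ENNReal.one_sub_inv_two]
    simp
  have hlim : ∀ᵐ ω ∂P, ∃ z : ℝ, Tendsto (fun k => Y (ns k) ω) atTop (𝓝 z) := by
    filter_upwards [ae_eventually_notMem hsum] with ω hω
    obtain ⟨K, hK⟩ := eventually_atTop.1 hω
    have hcs : CauchySeq fun k => Y (ns (k + K)) ω := by
      refine cauchySeq_of_le_geometric (1 / 2) 1 (by norm_num) fun k => ?_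
      have h := hK (k + K) (by omega)
      simp only [not_le] at h
      rw [dist_eq_norm, one_mul, show k + 1 + K = k + K + 1 by omega]
      exact h.le.trans (pow_le_pow_of_le_one (by norm_num) (by norm_num) (by omega))
    obtain ⟨z, hz⟩ := cauchySeq_tendsto_of_complete hcs
    exact ⟨z, (tendsto_add_atTop_iff_nat (f := fun k => Y (ns k) ω) K).1 hz⟩
  obtain ⟨Z, hZ, hYZ⟩ :=
    measurable_limit_of_tendsto_metrizable_ae (fun k => (hY (ns k)).aemeasurable) hlim
  refine ⟨Z, hZ, ?_⟩
  have hsub := tendstoInMeasure_of_tendsto_ae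
    (fun k => (hY (ns k)).aestronglyMeasurable) hYZ
  rw [tendstoInMeasure_iff_norm] at hsub ⊢
  intro ε hε
  -- The Cauchy hypothesis along the pairs `(n, ns n)` carries convergence from the subsequence to
  -- the whole sequence.
  have hpair : Tendsto (fun n : ℕ => (n, ns n)) atTop atTop := by
    rw [← prod_atTop_atTop_eq]
    exact tendsto_id.prodMk hns.tendsto_atTop
  have h₁ := (hC (ε / 2) (by positivity)).comp hpair
  have h₂ := hsub (ε / 2) (by positivity)
  have h₃ := h₁.add h₂
  rw [add_zero] at h₃
  refine tendsto_of_tendsto_of_tendsto_of_le_of_le tendsto_const_nhds h₃ (fun _ => zero_le) ?_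
  intro n
  refine (measure_mono ?_).trans (measure_union_le _ _)
  intro ω hω
  simp only [Set.mem_ofPred_eq, Set.mem_union, Pi.zero_apply, sub_zero] at hω ⊢
  by_contra! h
  have := norm_sub_le_norm_sub_add_norm_sub (Y n ω) (Y (ns n) ω) (Z ω)
  linarith [h.1, h.2]

/-- If the characteristic functions converge pointwise to `1`, the random variables converge to
`0` in probability. -/
theorem tendstoInMeasure_zero_of_charFun [IsProbabilityMeasure P] {ι : Type*} {l : Filter ι}
    [l.IsCountablyGenerated] {Y : ι → Ω → ℝ} (hY : ∀ i, Measurable (Y i))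
    (h : ∀ ξ : ℝ, Tendsto (fun i => charFun (P.map (Y i)) ξ) l (𝓝 1)) :
    TendstoInMeasure P Y l 0 := by
  rw [tendstoInMeasure_iff_measureReal_norm]
  intro ε hε
  have hprob : ∀ i, IsProbabilityMeasure (P.map (Y i)) := fun i =>
    Measure.isProbabilityMeasure_map (hY i).aemeasurable
  -- The tail estimate controls the strict event `r < |Y|`; halving `ε` makes it contain `ε ≤ |Y|`.
  set r : ℝ := ε / 2 with hr
  have hr0 : 0 < r := by positivity
  have hint : Tendsto (fun i => ∫ t in (-2 * r⁻¹)..(2 * r⁻¹), 1 - charFun (P.map (Y i)) t) l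
      (𝓝 (∫ _ in (-2 * r⁻¹)..(2 * r⁻¹), (0 : ℂ))) := by
    refine intervalIntegral.tendsto_integral_filter_of_dominated_convergence (fun _ => 2)
      (Eventually.of_forall fun i => ?_) (Eventually.of_forall fun i => ?_)
      intervalIntegrable_const ?_
    · exact (measurable_const.sub measurable_charFun).aestronglyMeasurable
    · refine Eventually.of_forall fun t _ => ?_
      exact norm_one_sub_charFun_le_two
    · refine Eventually.of_forall fun t _ => ?_
      simpa using (h t).const_sub 1
  have hbound := (hint.norm.const_mul (2⁻¹ * r))
  rw [intervalIntegral.integral_zero, norm_zero, mul_zero] at hbound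
  refine tendsto_of_tendsto_of_tendsto_of_le_of_le tendsto_const_nhds hbound
    (fun _ => measureReal_nonneg) fun i => ?_
  refine le_trans ?_ (measureReal_abs_gt_le_integral_charFun (μ := P.map (Y i)) hr0)
  rw [map_measureReal_apply (hY i) (measurableSet_lt measurable_const (by fun_prop))]
  refine measureReal_mono ?_
  intro ω hω
  simp only [Set.mem_ofPred_eq, Pi.zero_apply, sub_zero, Real.norm_eq_abs, Set.mem_preimage]
    at hω ⊢
  linarith

theorem charFun_eq_of_tendstoInMeasure [IsProbabilityMeasure P] {Y : ℕ → Ω → ℝ} {Z : Ω → ℝ}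
    (hY : ∀ n, Measurable (Y n)) (hZ : Measurable Z) (hYZ : TendstoInMeasure P Y atTop Z)
    {ξ : ℝ} {c : ℂ} (hc : Tendsto (fun n => charFun (P.map (Y n)) ξ) atTop (𝓝 c)) :
    charFun (P.map Z) ξ = c := by
  obtain ⟨ns, hns, hlim⟩ := hYZ.exists_seq_tendsto_ae
  refine tendsto_nhds_unique ?_ (hc.comp hns.tendsto_atTop)
  have hchar : ∀ V : Ω → ℝ, Measurable V →
      charFun (P.map V) ξ = ∫ ω, Complex.exp (ξ * V ω * Complex.I) ∂P := by
    intro V hV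
    rw [charFun_apply_real, integral_map hV.aemeasurable (by fun_prop)]
  rw [hchar Z hZ]
  simp only [Function.comp_def]
  simp_rw [fun n => hchar (Y (ns n)) (hY _)]
  refine tendsto_integral_of_dominated_convergence (fun _ => 1) (fun n => ?_)
    (integrable_const _) (fun n => Eventually.of_forall fun ω => ?_) ?_
  · have := hY (ns n)
    fun_prop
  · rw [← Complex.ofReal_mul, Complex.norm_exp_ofReal_mul_I]
  · filter_upwards [hlim] with ω hω
    have hcont : Continuous fun x : ℝ => Complex.exp (ξ * x * Complex.I) := by fun_prop
    exact (hcont.tendsto _).comp hω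

end ConvergenceInMeasure

/-! ### Mollified indicators -/

section Mollifier

variable {d : ℕ}

theorem IsMollifier.scaled_nonneg {θ : Test d} (hθ : IsMollifier θ) (n : ℕ)
    (t : EuclideanSpace ℝ (Fin d)) : 0 ≤ scaled θ n t :=
  mul_nonneg (by positivity) (hθ.1 _)

theorem IsMollifier.integral_scaled {θ : Test d} (hθ : IsMollifier θ) {n : ℕ} (hn : 0 < n) :
    ∫ t, scaled θ n t = 1 := by
  have hn' : (0 : ℝ) < n := by exact_mod_cast hn
  unfold scaled
  rw [integral_const_mul, Measure.integral_comp_smul_of_nonneg _ _ _ (hR := hn'.le), hθ.2,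
    finrank_euclideanSpace_fin, smul_eq_mul, mul_one, mul_inv_cancel₀ (by positivity)]

theorem integrable_scaled (θ : Test d) (n : ℕ) : Integrable (scaled θ n) :=
  (contDiff_scaled θ n).continuous.integrable_of_hasCompactSupport (hasCompactSupport_scaled θ n)

theorem mollifiedIndicator_eq (θ : Test d) (n : ℕ) (A : Set (EuclideanSpace ℝ (Fin d)))
    (x : EuclideanSpace ℝ (Fin d)) :
    mollifiedIndicator θ n A x
      = ∫ t, scaled θ n (x - t) • A.indicator (fun _ => (1 : ℝ)) t := by
  rw [mollifiedIndicator, convolution_eq_swap]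
  rfl

theorem IsMollifier.mollifiedIndicator_nonneg {θ : Test d} (hθ : IsMollifier θ) (n : ℕ)
    (A : Set (EuclideanSpace ℝ (Fin d))) (x : EuclideanSpace ℝ (Fin d)) :
    0 ≤ mollifiedIndicator θ n A x := by
  rw [mollifiedIndicator_eq]
  exact integral_nonneg fun t => mul_nonneg (hθ.scaled_nonneg n _)
    (Set.indicator_nonneg (fun _ _ => zero_le_one) t)

theorem IsMollifier.mollifiedIndicator_le_one {θ : Test d} (hθ : IsMollifier θ) {n : ℕ}
    (hn : 0 < n) (A : Set (EuclideanSpace ℝ (Fin d))) (x : EuclideanSpace ℝ (Fin d)) :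
    mollifiedIndicator θ n A x ≤ 1 := by
  have hone := hθ.integral_scaled hn
  rw [← integral_sub_left_eq_self (scaled θ n) volume x] at hone
  rw [mollifiedIndicator_eq]
  refine le_of_le_of_eq ?_ hone
  refine integral_mono_of_nonneg (Eventually.of_forall fun t => mul_nonneg (hθ.scaled_nonneg n _)
    (Set.indicator_nonneg (fun _ _ => zero_le_one) t))
    ((integrable_scaled θ n).comp_sub_left x) (Eventually.of_forall fun t => ?_)
  exact mul_le_of_le_one_right (hθ.scaled_nonneg n _)
    (Set.indicator_le_self' (fun _ _ => zero_le_one) t)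

/-- At almost every point, `θ_n * 𝟙_A` converges to `𝟙_A`. -/
theorem IsMollifier.ae_tendsto_mollifiedIndicator {θ : Test d} (hθ : IsMollifier θ)
    {A : Set (EuclideanSpace ℝ (Fin d))} (hA : MeasurableSet A) :
    ∀ᵐ x, Tendsto (fun n => mollifiedIndicator θ n A x) atTop
      (𝓝 (A.indicator (fun _ => (1 : ℝ)) x)) := by
  have hg : LocallyIntegrable (A.indicator fun _ => (1 : ℝ))
      (volume : Measure (EuclideanSpace ℝ (Fin d))) := (locallyIntegrable_const (1 : ℝ)).indicator hA
  obtain ⟨R, hR0, hR⟩ : ∃ R : ℝ, 0 < R ∧ tsupport θ ⊆ Metric.closedBall 0 R := by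
    obtain ⟨R, hR⟩ := θ.hasCompactSupport.isCompact.isBounded.subset_closedBall 0
    exact ⟨max R 1, by positivity, hR.trans (Metric.closedBall_subset_closedBall (le_max_left _ _))⟩
  obtain ⟨M, hM⟩ := θ.hasCompactSupport.exists_bound_of_continuous θ.continuous
  filter_upwards [(Besicovitch.vitaliFamily volume).ae_tendsto_average_norm_sub hg] with x hx
  have hδ : Tendsto (fun n : ℕ => R / n) atTop (𝓝[>] 0) :=
    tendsto_nhdsWithin_iff.2 ⟨tendsto_const_div_atTop_nhds_zero_nat R,
      (eventually_gt_atTop 0).mono fun n hn => by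
        have : (0 : ℝ) < n := by exact_mod_cast hn
        exact div_pos hR0 this⟩
  have havg := (hx.comp (Besicovitch.tendsto_filterAt volume x)).comp hδ
  simp_rw [mollifiedIndicator_eq]
  refine tendsto_integral_smul_of_tendsto_average_norm_sub
    (a := fun n : ℕ => Metric.closedBall x (R / n))
    -- Since `θ_n ≤ n ^ d M` and a ball of radius `R / n` has volume `n ^ (-d)` times that of radius
    -- `R`, this constant bounds the kernel by a multiple of the normalized indicator of the ball.
    (M * (volume : Measure (EuclideanSpace ℝ (Fin d))).real (Metric.closedBall 0 R)) havg
    (Eventually.of_forall fun n => hg.integrableOn_isCompact (isCompact_closedBall _ _)) ?_ ?_ ?_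
  · refine tendsto_const_nhds.congr' ((eventually_gt_atTop 0).mono fun n hn => ?_)
    exact ((integral_sub_left_eq_self (scaled θ n) volume x).trans
      (hθ.integral_scaled hn)).symm
  · filter_upwards [eventually_gt_atTop 0] with n hn t ht
    have hn' : (0 : ℝ) < n := by exact_mod_cast hn
    have h1 : θ ((n : ℝ) • (x - t)) ≠ 0 := fun h => ht (by simp [scaled, h])
    have h2 := hR (subset_tsupport _ h1)
    rw [mem_closedBall_zero_iff, norm_smul, Real.norm_of_nonneg hn'.le] at h2
    rw [mem_closedBall_iff_norm', le_div_iff₀ hn']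
    linarith
  · filter_upwards [eventually_gt_atTop 0] with n hn t
    have hn' : (0 : ℝ) < n := by exact_mod_cast hn
    have hvol : (volume : Measure (EuclideanSpace ℝ (Fin d))).real (Metric.closedBall x (R / n))
        = (volume : Measure (EuclideanSpace ℝ (Fin d))).real (Metric.closedBall 0 R) / n ^ d := by
      rw [Measure.addHaar_real_closedBall _ _ (div_pos hR0 hn').le,
        Measure.addHaar_real_closedBall _ _ hR0.le, finrank_euclideanSpace_fin, div_pow]
      ring
    have hpos : 0 < (volume : Measure (EuclideanSpace ℝ (Fin d))).real
        (Metric.closedBall 0 R) := by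
      rw [measureReal_def]
      exact ENNReal.toReal_pos (Metric.measure_closedBall_pos _ _ hR0).ne'
        measure_closedBall_lt_top.ne
    rw [hvol, abs_of_nonneg (hθ.scaled_nonneg n _), scaled]
    have h3 : θ ((n : ℝ) • (x - t)) ≤ M := (le_abs_self _).trans (hM _)
    calc (n : ℝ) ^ d * θ ((n : ℝ) • (x - t)) ≤ (n : ℝ) ^ d * M := by gcongr
      _ = _ := by field_simp

end Mollifier

/-! ### Dominated convergence of test functions -/

section DominatedLimit

variable {d : ℕ} {ι : Type*} {l : Filter ι}

/-- The test functions `g i` are eventually dominated by a multiple of `φ` and converge to `G`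
almost everywhere. -/
def TendstoDominated (φ : Test d) (g : ι → Test d) (l : Filter ι)
    (G : EuclideanSpace ℝ (Fin d) → ℝ) : Prop :=
  (∃ C : ℝ, ∀ᶠ i in l, ∀ t, |g i t| ≤ C * |φ t|) ∧
    ∀ᵐ t, Tendsto (fun i => g i t) l (𝓝 (G t))

theorem TendstoDominated.linearCombination {φ : Test d} {g h : ι → Test d}
    {G H : EuclideanSpace ℝ (Fin d) → ℝ} (hg : TendstoDominated φ g l G)
    (hh : TendstoDominated φ h l H) (a b : ℝ) :
    TendstoDominated φ (fun i => a • g i + b • h i) l (fun t => a * G t + b * H t) := by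
  obtain ⟨⟨C, hC⟩, hG⟩ := hg
  obtain ⟨⟨D, hD⟩, hH⟩ := hh
  refine ⟨⟨|a| * C + |b| * D, ?_⟩, ?_⟩
  · filter_upwards [hC, hD] with i hi hi' t
    calc |a * g i t + b * h i t| ≤ |a * g i t| + |b * h i t| := abs_add_le _ _
      _ = |a| * |g i t| + |b| * |h i t| := by rw [abs_mul, abs_mul]
      _ ≤ |a| * (C * |φ t|) + |b| * (D * |φ t|) := by
        gcongr
        exacts [hi t, hi' t]
      _ = _ := by ring
  · filter_upwards [hG, hH] with t ht ht'
    exact (ht.const_mul a).add (ht'.const_mul b)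

theorem TendstoDominated.comp {κ : Type*} {l' : Filter κ} {φ : Test d} {g : ι → Test d}
    {G : EuclideanSpace ℝ (Fin d) → ℝ} (hg : TendstoDominated φ g l G) {u : κ → ι}
    (hu : Tendsto u l' l) : TendstoDominated φ (g ∘ u) l' G :=
  ⟨hg.1.imp fun _ hC => hu.eventually hC, hg.2.mono fun _ ht => ht.comp hu⟩

theorem TendstoDominated.tendsto_integral [l.IsCountablyGenerated] {ψ : ℝ → ℂ}
    (hψ : Continuous ψ) (hψ0 : ψ 0 = 0) {φ : Test d} {g : ι → Test d}
    {G : EuclideanSpace ℝ (Fin d) → ℝ} (hg : TendstoDominated φ g l G) :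
    Tendsto (fun i => ∫ t, ψ (g i t)) l (𝓝 (∫ t, ψ (G t))) := by
  obtain ⟨⟨C, hC⟩, hG⟩ := hg
  obtain ⟨M, hM⟩ := φ.hasCompactSupport.exists_bound_of_continuous φ.continuous
  -- All values `g i t` eventually lie in this compact ball. Off `tsupport φ` the domination forces
  -- `g i t = 0`, where `ψ` vanishes, so `B` on `tsupport φ` is an integrable majorant.
  obtain ⟨B, hB⟩ := (isCompact_closedBall (0 : ℝ) (|C| * M)).exists_bound_of_continuousOn
    hψ.continuousOn
  refine tendsto_integral_filter_of_dominated_convergence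
    ((tsupport φ).indicator fun _ => B)
    (Eventually.of_forall fun i => (hψ.comp (g i).continuous).aestronglyMeasurable) ?_ ?_ ?_
  · filter_upwards [hC] with i hi
    refine Eventually.of_forall fun t => ?_
    by_cases ht : t ∈ tsupport φ
    · rw [Set.indicator_of_mem ht]
      refine hB _ ?_
      rw [mem_closedBall_zero_iff, Real.norm_eq_abs]
      calc |g i t| ≤ C * |φ t| := hi t
        _ ≤ |C| * |φ t| := by gcongr; exact le_abs_self C
        _ ≤ |C| * M := by gcongr; exact hM t
    · have h0 : g i t = 0 := by
        have := hi t
        rw [image_eq_zero_of_notMem_tsupport ht, abs_zero, mul_zero] at this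
        exact abs_nonpos_iff.1 this
      rw [Set.indicator_of_notMem ht, h0, hψ0, norm_zero]
  · exact (integrable_indicator_iff (isClosed_tsupport _).measurableSet).2
      (integrableOn_const φ.hasCompactSupport.isCompact.measure_lt_top.ne)
  · filter_upwards [hG] with t ht
    exact (hψ.tendsto _).comp ht

theorem tendstoDominated_cutoff (φ : Test d) {θ : Test d} (hθ : IsMollifier θ)
    {A : Set (EuclideanSpace ℝ (Fin d))} (hA : MeasurableSet A) :
    TendstoDominated φ (fun n => cutoff φ θ n hA) atTop (A.indicator φ) := by
  refine ⟨⟨1, ?_⟩, ?_⟩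
  · filter_upwards [eventually_gt_atTop 0] with n hn t
    change |φ t * mollifiedIndicator θ n A t| ≤ 1 * |φ t|
    rw [abs_mul, abs_of_nonneg (hθ.mollifiedIndicator_nonneg n A t), mul_comm]
    gcongr
    exact hθ.mollifiedIndicator_le_one hn A t
  · filter_upwards [hθ.ae_tendsto_mollifiedIndicator hA] with t ht
    have := ht.const_mul (φ t)
    rwa [← Set.indicator_mul_right A (fun t => φ t) (fun _ => (1 : ℝ)),
      Set.indicator_congr (g := φ) fun _ _ => mul_one _] at this

end DominatedLimit

/-! ### Limits of white noise pairings -/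

section WhiteNoise

variable {d : ℕ} {Ω : Type*} [MeasurableSpace Ω] {P : Measure Ω}

namespace GeneralizedRandomProcess

variable (X : GeneralizedRandomProcess d P)

theorem pairing_zero : X.pairing 0 =ᵐ[P] 0 := by
  filter_upwards [X.linear 0 0 1] with ω hω
  simpa using hω

theorem pairing_smul (c : ℝ) (u : Test d) :
    X.pairing (c • u) =ᵐ[P] fun ω => c * X.pairing u ω := by
  filter_upwards [X.linear 0 u c, X.pairing_zero] with ω hω h0
  rw [zero_add] at hω
  rw [hω, h0, Pi.zero_apply, zero_add]

theorem pairing_linearCombination (a b : ℝ) (u v : Test d) :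
    X.pairing (a • u + b • v) =ᵐ[P] fun ω => a * X.pairing u ω + b * X.pairing v ω := by
  filter_upwards [X.linear (a • u) v b, X.pairing_smul a u] with ω hω ha
  rw [hω, ha]

end GeneralizedRandomProcess

namespace IsLevyWhiteNoise

variable {X : GeneralizedRandomProcess d P} {ψ : ℝ → ℂ}

theorem charFun_pairing (hX : IsLevyWhiteNoise X ψ) (u : Test d) (ξ : ℝ) :
    charFun (P.map (X.pairing u)) ξ = Complex.exp (∫ t, ψ (ξ * u t)) := by
  refine Eq.trans ?_ (hX.2 (ξ • u))
  rw [charFun_apply_real,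
    integral_map (X.measurable_pairing u).aemeasurable (by fun_prop)]
  refine integral_congr_ae ?_
  filter_upwards [X.pairing_smul ξ u] with ω hω
  rw [hω]
  push_cast
  ring_nf

theorem tendsto_charFun (hX : IsLevyWhiteNoise X ψ) {ι : Type*} {l : Filter ι}
    [l.IsCountablyGenerated] {φ : Test d} {g : ι → Test d} {G : EuclideanSpace ℝ (Fin d) → ℝ}
    (hg : TendstoDominated φ g l G) (ξ : ℝ) :
    Tendsto (fun i => charFun (P.map (X.pairing (g i))) ξ) l
      (𝓝 (Complex.exp (∫ t, ψ (ξ * G t)))) := by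
  simp_rw [hX.charFun_pairing]
  refine (Complex.continuous_exp.tendsto _).comp (hg.tendsto_integral
    (hX.1.1.comp (continuous_const_mul ξ)) ?_)
  simp [hX.1.2.1]

theorem tendstoInMeasure_zero [IsProbabilityMeasure P] (hX : IsLevyWhiteNoise X ψ) {ι : Type*}
    {l : Filter ι} [l.IsCountablyGenerated] {φ : Test d} {g : ι → Test d}
    (hg : TendstoDominated φ g l 0) :
    TendstoInMeasure P (fun i => X.pairing (g i)) l 0 := by
  refine tendstoInMeasure_zero_of_charFun (fun i => X.measurable_pairing _) fun ξ => ?_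
  simpa [hX.1.2.1] using hX.tendsto_charFun hg ξ

theorem charFun_limit [IsProbabilityMeasure P] (hX : IsLevyWhiteNoise X ψ) {φ : Test d}
    {g : ℕ → Test d} {G : EuclideanSpace ℝ (Fin d) → ℝ} (hg : TendstoDominated φ g atTop G)
    {Y : Ω → ℝ} (hY : Measurable Y)
    (hlim : TendstoInMeasure P (fun n => X.pairing (g n)) atTop Y) (ξ : ℝ) :
    charFun (P.map Y) ξ = Complex.exp (∫ t, ψ (ξ * G t)) :=
  charFun_eq_of_tendstoInMeasure (fun _ => X.measurable_pairing _) hY hlim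
    (hX.tendsto_charFun hg ξ)

theorem exists_limit [IsProbabilityMeasure P] (hX : IsLevyWhiteNoise X ψ) {φ : Test d}
    {g : ℕ → Test d} {G : EuclideanSpace ℝ (Fin d) → ℝ} (hg : TendstoDominated φ g atTop G) :
    ∃ Y : Ω → ℝ, Measurable Y ∧
      TendstoInMeasure P (fun n => X.pairing (g n)) atTop Y := by
  refine exists_tendstoInMeasure_of_cauchy (fun _ => X.measurable_pairing _) ?_
  have hfst : Tendsto (Prod.fst : ℕ × ℕ → ℕ) atTop atTop := by
    rw [← prod_atTop_atTop_eq]; exact tendsto_fst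
  have hsnd : Tendsto (Prod.snd : ℕ × ℕ → ℕ) atTop atTop := by
    rw [← prod_atTop_atTop_eq]; exact tendsto_snd
  have h := (hg.comp hfst).linearCombination (hg.comp hsnd) 1 (-1)
  have h0 : (fun t => 1 * G t + -1 * G t) = 0 := by
    funext t
    simp
  rw [h0] at h
  refine (hX.tendstoInMeasure_zero h).congr_left fun p => ?_
  filter_upwards [X.pairing_linearCombination 1 (-1) (g p.1) (g p.2)] with ω hω
  simp only [Function.comp, hω]
  ring

theorem tendstoInMeasure_linearCombination [IsProbabilityMeasure P] {g h : ℕ → Test d}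
    {Y Z : Ω → ℝ} (hY : TendstoInMeasure P (fun n => X.pairing (g n)) atTop Y)
    (hZ : TendstoInMeasure P (fun n => X.pairing (h n)) atTop Z) (a b : ℝ) :
    TendstoInMeasure P (fun n => X.pairing (a • g n + b • h n)) atTop
      (fun ω => a * Y ω + b * Z ω) :=
  (TendstoInMeasure.linearCombination (fun _ => X.measurable_pairing _)
    (fun _ => X.measurable_pairing _) hY hZ a b).congr_left
    fun n => (X.pairing_linearCombination a b (g n) (h n)).symm

/-- The limit in probability only depends on the almost everywhere limit of the test functions. -/
theorem limit_unique [IsProbabilityMeasure P] (hX : IsLevyWhiteNoise X ψ) {φ : Test d}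
    {g h : ℕ → Test d} {G : EuclideanSpace ℝ (Fin d) → ℝ} (hg : TendstoDominated φ g atTop G)
    (hh : TendstoDominated φ h atTop G) {Y Z : Ω → ℝ}
    (hY : TendstoInMeasure P (fun n => X.pairing (g n)) atTop Y)
    (hZ : TendstoInMeasure P (fun n => X.pairing (h n)) atTop Z) : Y =ᵐ[P] Z := by
  have hgh := hg.linearCombination hh 1 (-1)
  have h0 : (fun t => 1 * G t + -1 * G t) = 0 := by
    funext t
    simp
  rw [h0] at hgh
  filter_upwards [tendstoInMeasure_ae_unique
    (tendstoInMeasure_linearCombination hY hZ 1 (-1)) (hX.tendstoInMeasure_zero hgh)] with ω hω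
  rw [Pi.zero_apply] at hω
  linarith

theorem comp_indicator (hX : IsLevyWhiteNoise X ψ) (f : EuclideanSpace ℝ (Fin d) → ℝ)
    (A : Set (EuclideanSpace ℝ (Fin d))) (ξ : ℝ) :
    (fun t => ψ (ξ * A.indicator f t)) = A.indicator fun t => ψ (ξ * f t) := by
  funext t
  by_cases ht : t ∈ A <;> simp [ht, hX.1.2.1]

theorem integrable_comp_indicator (hX : IsLevyWhiteNoise X ψ) (φ : Test d)
    {A : Set (EuclideanSpace ℝ (Fin d))} (hA : MeasurableSet A) (ξ : ℝ) :
    Integrable fun t => ψ (ξ * A.indicator φ t) := by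
  rw [hX.comp_indicator]
  refine Integrable.indicator ?_ hA
  refine Continuous.integrable_of_hasCompactSupport
    (hX.1.1.comp (continuous_const.mul φ.continuous)) ?_
  exact φ.hasCompactSupport.comp_left (g := fun x => ψ (ξ * x)) (by simp [hX.1.2.1])

/-- Limits along test functions converging to functions with disjoint supports are independent. -/
theorem indepFun_limit [IsProbabilityMeasure P] (hX : IsLevyWhiteNoise X ψ) {φ : Test d}
    {g h : ℕ → Test d} {A B : Set (EuclideanSpace ℝ (Fin d))} (hA : MeasurableSet A)
    (hB : MeasurableSet B) (hAB : Disjoint A B) (hg : TendstoDominated φ g atTop (A.indicator φ))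
    (hh : TendstoDominated φ h atTop (B.indicator φ)) {Y Z : Ω → ℝ} (hY : Measurable Y)
    (hZ : Measurable Z) (hgY : TendstoInMeasure P (fun n => X.pairing (g n)) atTop Y)
    (hhZ : TendstoInMeasure P (fun n => X.pairing (h n)) atTop Z) : IndepFun Y Z P := by
  rw [indepFun_iff_charFun_prod hY.aemeasurable hZ.aemeasurable]
  intro t
  -- Cramér–Wold: the joint characteristic function at `t` is that of a linear combination at `1`,
  -- itself a limit of pairings.
  have hjoint : charFun (P.map fun ω => WithLp.toLp 2 (Y ω, Z ω)) t
      = charFun (P.map fun ω => t.fst * Y ω + t.snd * Z ω) 1 := by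
    rw [charFun_apply, charFun_apply_real, integral_map (by fun_prop) (by fun_prop),
      integral_map (by fun_prop) (by fun_prop)]
    simp [WithLp.prod_inner_apply]
  rw [hjoint, hX.charFun_limit (hg.linearCombination hh t.fst t.snd) (by fun_prop)
      (tendstoInMeasure_linearCombination hgY hhZ _ _),
    hX.charFun_limit hg hY hgY, hX.charFun_limit hh hZ hhZ, ← Complex.exp_add,
    ← integral_add (hX.integrable_comp_indicator φ hA _) (hX.integrable_comp_indicator φ hB _)]
  congr 2
  funext x
  by_cases hxA : x ∈ A
  · have hxB : x ∉ B := fun hxB => hAB.notMem_of_mem_left hxA hxB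
    simp [hxA, hxB, hX.1.2.1]
  · simp [hxA, hX.1.2.1]

end IsLevyWhiteNoise

end WhiteNoise

end LevyNoise

end

theorem proposition3p2 {d : ℕ} {Ω : Type*} [MeasurableSpace Ω] (P : Measure Ω)
    [IsProbabilityMeasure P] (X : LevyNoise.GeneralizedRandomProcess d P) (ψ : ℝ → ℂ)
    (hX : LevyNoise.IsLevyWhiteNoise X ψ) (φ : LevyNoise.Test d) :
    -- the limit in probability exists, for every mollifier
    (∀ (A : Set (EuclideanSpace ℝ (Fin d))) (hA : MeasurableSet A) (θ : LevyNoise.Test d),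
      LevyNoise.IsMollifier θ → ∃ Y : Ω → ℝ, LevyNoise.IsPairingLimit X φ θ hA Y) ∧
    -- it is almost surely unique and does not depend on the mollifier
    (∀ (A : Set (EuclideanSpace ℝ (Fin d))) (hA : MeasurableSet A) (θ θ' : LevyNoise.Test d),
      LevyNoise.IsMollifier θ → LevyNoise.IsMollifier θ' → ∀ Y Y' : Ω → ℝ,
      LevyNoise.IsPairingLimit X φ θ hA Y → LevyNoise.IsPairingLimit X φ θ' hA Y' →
      Y =ᵐ[P] Y') ∧
    -- its characteristic function
    (∀ (A : Set (EuclideanSpace ℝ (Fin d))) (hA : MeasurableSet A) (θ : LevyNoise.Test d),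
      LevyNoise.IsMollifier θ → ∀ Y : Ω → ℝ, LevyNoise.IsPairingLimit X φ θ hA Y →
      ∀ ξ : ℝ, ∫ ω, Complex.exp (Complex.I * (ξ : ℂ) * (Y ω : ℂ)) ∂P
        = Complex.exp (∫ t in A, ψ (ξ * φ t))) ∧
    -- additivity over disjoint sets, and independence
    (∀ (A B : Set (EuclideanSpace ℝ (Fin d))) (hA : MeasurableSet A) (hB : MeasurableSet B),
      Disjoint A B → ∀ θ₁ θ₂ θ₃ : LevyNoise.Test d,
      LevyNoise.IsMollifier θ₁ → LevyNoise.IsMollifier θ₂ → LevyNoise.IsMollifier θ₃ →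
      ∀ Y Z W : Ω → ℝ, LevyNoise.IsPairingLimit X φ θ₁ hA Y →
      LevyNoise.IsPairingLimit X φ θ₂ hB Z →
      LevyNoise.IsPairingLimit X φ θ₃ (hA.union hB) W →
      (W =ᵐ[P] fun ω => Y ω + Z ω) ∧ IndepFun Y Z P) := by
  refine ⟨?_, ?_, ?_, ?_⟩
  · intro A hA θ hθ
    exact hX.exists_limit (LevyNoise.tendstoDominated_cutoff φ hθ hA)
  · intro A hA θ θ' hθ hθ' Y Y' hY hY'
    exact hX.limit_unique (LevyNoise.tendstoDominated_cutoff φ hθ hA)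
      (LevyNoise.tendstoDominated_cutoff φ hθ' hA) hY.2 hY'.2
  · intro A hA θ hθ Y hY ξ
    have h := hX.charFun_limit (LevyNoise.tendstoDominated_cutoff φ hθ hA) hY.1 hY.2 ξ
    rw [hX.comp_indicator, integral_indicator hA, charFun_apply_real,
      integral_map hY.1.aemeasurable (by fun_prop)] at h
    rw [← h]
    congr 1
    funext ω
    ring_nf
  · intro A B hA hB hAB θ₁ θ₂ θ₃ hθ₁ hθ₂ hθ₃ Y Z W hY hZ hW
    have hA' := LevyNoise.tendstoDominated_cutoff φ hθ₁ hA
    have hB' := LevyNoise.tendstoDominated_cutoff φ hθ₂ hB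
    refine ⟨?_, hX.indepFun_limit hA hB hAB hA' hB' hY.1 hZ.1 hY.2 hZ.2⟩
    -- With different mollifiers the sum of the two cutoffs need not be a cutoff for `A ∪ B`, but it
    -- has the same a.e. limit, which is all `limit_unique` needs.
    have hsum := hA'.linearCombination hB' 1 1
    simp_rw [one_mul, ← Set.indicator_union_of_disjoint hAB] at hsum
    have hlim := LevyNoise.IsLevyWhiteNoise.tendstoInMeasure_linearCombination hY.2 hZ.2 1 1
    simp_rw [one_mul] at hlim
    exact hX.limit_unique (LevyNoise.tendstoDominated_cutoff φ hθ₃ (hA.union hB)) hsum hW.2 hlim
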